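/- Let $K$ be an infinite field, let $1\le i\le j\le n$ be integers, let $S=K[x_1,\ldots,x_n]$ with the standard grading, and let $$I=(x_{l_1}\cdots x_{l_{j+1}} : i\le l_1\le\cdots\le l_{j+1}\le n)\subseteq S.$$ Definitions. For a graded ideal $L\subseteq S$ and a $K$-basis $v_1,\ldots,v_n$ of $S_1$, let $\alpha_{p,q}(v_1,\ldots,v_n;S/L)$ be, for $1\le p\le n$ and $q\geq 0$, the $K$-dimension of the degree $q$ component of $0:_{S/(L+(v_1,\ldots,v_{p-1}))}v_p$, and put $\alpha_{n+1,q}(v_1,\ldots,v_n;S/L)=\beta_{0,q}(S/L)=\dim_K (S/(L+(x_1,\ldots,x_n)))_q$ (symmetric annihilator numbers). Let $<_{\mathrm{rlex}}$ be the reverse lexicographic order with $x_1<\cdots<x_n$ (for monomials of equal degree, $x^a<_{\mathrm{rlex}}x^b$ if $a_k>b_k$ for the smallest $k$ with $a_k\ne b_k$). Let $\mathrm{gin}(L)$ be the generic initial ideal of $L$, i.e. the ideal that is the initial ideal with respect to $<_{\mathrm{rlex}}$ of $\gamma(L)$ for all $\gamma$ in some non-empty Zariski-open subset of $GL_n(K)$,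 where $\gamma(x_k)=\sum_l\gamma_{l,k}x_l$. The symmetric generic annihilator numbers of $S/L$ are $\alpha_{p,q}(S/L)=\alpha_{p,q}(x_1,\ldots,x_n;S/\mathrm{gin}(L))$. A monomial ideal $L$ is strongly stable if $x_l(u/x_k)\in L$ for every monomial $u\in L$, every $x_k$ dividing $u$ and every $l>k$. Then: 1. $I$ is a graded, strongly stable monomial ideal, and $\mathrm{gin}(I)=I$; hence $\alpha_{p,q}(S/I)=\alpha_{p,q}(x_1,\ldots,x_n;S/I)$ for all $1\le p\le n+1$ and $q\ge 0$. 2. If $i\ge 2$, then the sequence $\mathbf{x}=x_1,\ldots,x_{i-2},x_i,x_{i-1},x_{i+1},\ldots,x_n$ is a $K$-basis of $S_1$ and $$\alpha_{i,j}(S/I)>\alpha_{i,j}(\mathbf{x};S/I),\qquad \alpha_{i-1,j}(S/I)<\alpha_{i-1,j}(\mathbf{x};S/I).$$ In particular, it is not true that $\alpha_{p,q}(S/I)\le\alpha_{p,q}(v_1,\ldots,v_n;S/I)$ for all $K$-bases $v_1,\ldots,v_n$ of $S_1$, all $1\le p\le n$ and all $q\ge 0$: the symmetric generic annihilator numbers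 are not minimal among the symmetric annihilator numbers with respect to a sequence. -/

import Mathlib

open MvPolynomial

noncomputable section

/-! Throughout, `MvPolynomial (Fin n) K` is `S = K[x_1, …, x_n]`, where the variable
`x_k` (`1 ≤ k ≤ n`) is `X` at the index with value `k - 1`; thus `x_1 < ⋯ < x_n` is the order
of `Fin n`. -/

/-- `v_1, …, v_n` is a `K`-basis of the space `S_1` of linear forms. -/
def IsLinearFormBasis {K : Type*} [Field K] {n : ℕ} (v : Fin n → MvPolynomial (Fin n) K) : Prop :=
  LinearIndependent K v ∧ Submodule.span K (Set.range v) = homogeneousSubmodule (Fin n) K 1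

section AnnihilatorNumbers

variable {K : Type*} [Field K] {n : ℕ}
variable (M : Type*) [AddCommGroup M] [Module K M] [Module (MvPolynomial (Fin n) K) M]
  [IsScalarTower K (MvPolynomial (Fin n) K) M]

/-- The submodule `(v_1, …, v_r) M` of `M`. -/
def seqSubmodule (v : Fin n → MvPolynomial (Fin n) K) (r : ℕ) :
    Submodule (MvPolynomial (Fin n) K) M :=
  Ideal.span {f | ∃ k : Fin n, k.val < r ∧ v k = f} •
    (⊤ : Submodule (MvPolynomial (Fin n) K) M)

variable {M}

/-- For a module `M` with graded components `𝓜 j`, the degree `j` component of `M / N`. -/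
def quotientComponent (𝓜 : ℕ → Submodule K M) (N : Submodule (MvPolynomial (Fin n) K) M)
    (j : ℕ) : Submodule K (M ⧸ N) :=
  (𝓜 j).map (N.mkQ.restrictScalars K)

/-- The degree `j` component of `0 :_{M / (v_1, …, v_r) M} v_{r + 1}`, where `r` is the value of
the (zero-based) index `k`, so that `v k` is the `(r + 1)`-st member of the sequence. -/
def annihilatorComponent (𝓜 : ℕ → Submodule K M) (v : Fin n → MvPolynomial (Fin n) K)
    (k : Fin n) (j : ℕ) : Submodule K (M ⧸ seqSubmodule M v k.val) :=
  (Submodule.torsionBy (MvPolynomial (Fin n) K) (M ⧸ seqSubmodule M v k.val)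
      (v k)).restrictScalars K ⊓
    quotientComponent 𝓜 (seqSubmodule M v k.val) j

/-- The symmetric annihilator numbers `α_{i,j}(v_1, …, v_n; M)` of a finitely generated graded
`S`-module `M` with graded components `𝓜 j`, for `1 ≤ i ≤ n + 1`.  For `i = n + 1` this is
`β_{0,j}(M) = dim_K (M / (x_1, …, x_n) M)_j`.  (The value is `0` for all other `i`.) -/
def symAnnihilatorNumber (𝓜 : ℕ → Submodule K M) (v : Fin n → MvPolynomial (Fin n) K)
    (i j : ℕ) : ℕ :=
  if h : 1 ≤ i ∧ i ≤ n then
    Module.finrank K (annihilatorComponent 𝓜 v ⟨i - 1, by omega⟩ j)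
  else if i = n + 1 then
    Module.finrank K (quotientComponent 𝓜 (seqSubmodule M (X : Fin n → MvPolynomial (Fin n) K) n) j)
  else 0

end AnnihilatorNumbers

section GenericInitialIdeal

variable {K : Type*} [Field K] {n : ℕ}

/-- The standard grading of `S / I`. -/
def quotientRingGrading (I : Ideal (MvPolynomial (Fin n) K)) (j : ℕ) :
    Submodule K (MvPolynomial (Fin n) K ⧸ I) :=
  (homogeneousSubmodule (Fin n) K j).map (Ideal.Quotient.mkₐ K I).toLinearMap

/-- `x^a <_rlex x^b` for the (degree) reverse lexicographic order with `x_1 < ⋯ < x_n`: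
`x^a` has smaller degree, or both have the same degree and, at the smallest variable whose
exponents differ, `x^a` has the larger exponent. -/
def RlexLT (a b : Fin n →₀ ℕ) : Prop :=
  a.degree < b.degree ∨
    (a.degree = b.degree ∧ ∃ k, (∀ l < k, a l = b l) ∧ b k < a k)

/-- The initial ideal of `I` with respect to `<_rlex`. -/
def rlexInitialIdeal (I : Ideal (MvPolynomial (Fin n) K)) : Ideal (MvPolynomial (Fin n) K) :=
  Ideal.span {m | ∃ f ∈ I, ∃ a ∈ f.support,
    (∀ b ∈ f.support, b ≠ a → RlexLT b a) ∧ m = monomial a 1}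

/-- The action of `γ ∈ GL_n(K)` on `S`: `x_k ↦ γ_{1,k} x_1 + ⋯ + γ_{n,k} x_n`. -/
def linearSubstitution (γ : GL (Fin n) K) :
    MvPolynomial (Fin n) K →ₐ[K] MvPolynomial (Fin n) K :=
  aeval fun k => ∑ l, C (γ.val l k) * X l

/-- Zariski-open subsets of `GL_n(K)`: unions of non-vanishing loci of polynomials in the
matrix entries. -/
def IsZariskiOpen (U : Set (GL (Fin n) K)) : Prop :=
  ∃ F : Set (MvPolynomial (Fin n × Fin n) K),
    U = {γ | ∃ p ∈ F, eval (fun e => γ.val e.1 e.2) p ≠ 0}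

/-- `G` is the initial ideal of `γ(I)` for all `γ` in a non-empty Zariski-open subset of
`GL_n(K)`. Over an infinite field there is at most one such `G`, as any two non-empty Zariski-open
subsets meet. -/
def IsRlexGin (I G : Ideal (MvPolynomial (Fin n) K)) : Prop :=
  ∃ U : Set (GL (Fin n) K), U.Nonempty ∧ IsZariskiOpen U ∧
    ∀ γ ∈ U, rlexInitialIdeal (I.map (linearSubstitution γ)) = G

open Classical in
/-- The generic initial ideal of `I` with respect to `<_rlex`. -/
def rlexGin (I : Ideal (MvPolynomial (Fin n) K)) : Ideal (MvPolynomial (Fin n) K) :=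
  if h : ∃ G, IsRlexGin I G then h.choose else ⊥

/-- `α_{i,j}(v_1, …, v_n; S / I)`. -/
def symAnnihilatorNumberQuot (I : Ideal (MvPolynomial (Fin n) K))
    (v : Fin n → MvPolynomial (Fin n) K) (i j : ℕ) : ℕ :=
  symAnnihilatorNumber (quotientRingGrading I) v i j

/-- The symmetric generic annihilator numbers
`α_{i,j}(S / I) = α_{i,j}(x_1, …, x_n; S / gin(I))`. -/
def symGenericAnnihilatorNumber (I : Ideal (MvPolynomial (Fin n) K)) (i j : ℕ) : ℕ :=
  symAnnihilatorNumberQuot (rlexGin I) X i j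

/-- `I` is a graded ideal: it contains the homogeneous components of its members. -/
def IsGradedIdeal (I : Ideal (MvPolynomial (Fin n) K)) : Prop :=
  ∀ f ∈ I, ∀ d : ℕ, homogeneousComponent d f ∈ I

/-- `I` is a strongly stable monomial ideal (for `x_1 < ⋯ < x_n`): it contains every monomial
that occurs in one of its members, and for every monomial `u ∈ I`, every `x_k` dividing `u` and
every `l > k`, the monomial `x_l (u / x_k)` is in `I`. -/
def IsStronglyStable (I : Ideal (MvPolynomial (Fin n) K)) : Prop :=
  (∀ f ∈ I, ∀ a ∈ f.support, monomial a (1 : K) ∈ I) ∧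
    ∀ a : Fin n →₀ ℕ, monomial a (1 : K) ∈ I → ∀ k l : Fin n, k < l → a k ≠ 0 →
      monomial (a - Finsupp.single k 1 + Finsupp.single l 1) (1 : K) ∈ I

end GenericInitialIdeal

/-- The ideal `(x_{l_1} ⋯ x_{l_{j+1}} : i ≤ l_1 ≤ ⋯ ≤ l_{j+1} ≤ n)` of `K[x_1, …, x_n]`. -/
def upperIdeal (K : Type*) [Field K] (n i j : ℕ) : Ideal (MvPolynomial (Fin n) K) :=
  Ideal.span {m | ∃ l : Fin (j + 1) → Fin n, Monotone l ∧ (∀ t, i ≤ (l t).val + 1) ∧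
    m = ∏ t, X (l t)}

/-- The sequence `x_1, …, x_{i-2}, x_i, x_{i-1}, x_{i+1}, …, x_n`. -/
def swappedVariables (K : Type*) [Field K] (n i : ℕ) (h2 : 2 ≤ i) (hn : i ≤ n) :
    Fin n → MvPolynomial (Fin n) K :=
  fun k => X (Equiv.swap (⟨i - 2, by omega⟩ : Fin n) ⟨i - 1, by omega⟩ k)

end

/-!
Write `P = (x_i, …, x_n)`. The ideal in question is `P ^ (j + 1)`, so a polynomial lies in it iff
each of its monomials has degree at least `j + 1` in `x_i, …, x_n` (`upperIdeal_eq_pow`,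
`mem_upperIdeal`); gradedness and strong stability are read off from this.

For the generic initial ideal, take the open set of those `γ` whose block `B` with the rows and
columns `i, …, n` is invertible. Multiplying the linear forms `γ(x_i), …, γ(x_n)` by `B⁻¹` replaces
them by forms `y_k = x_k + (a combination of x_1, …, x_{i-1})` with the same span
(`X_add_sum_lowerCoeff`), so `γ(P ^ (j + 1)) = (y_i, …, y_n) ^ (j + 1)`. The substitution
`x_k ↦ y_k` and its inverse add to each variable only smaller monomials, and such substitutions
preserve leading monomials (`IsUnitriangular.isRlexLeading`). Hence `γ(P ^ (j + 1))` has the same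
initial ideal as the monomial ideal `P ^ (j + 1)`, namely `P ^ (j + 1)`
(`rlexInitialIdeal_map_upperIdeal`). Uniqueness of the generic initial ideal is the fact that two
non-empty Zariski-open sets meet over an infinite field.

For the annihilator numbers along a permutation of the variables, everything modulo which one works
is a monomial ideal (`mem_upperIdeal_sup`). A variable among `x_1, …, x_{i-1}` is a nonzerodivisor
modulo the ideal and the variables before it, so its annihilator numbers are zero. For a variable
`x_k` with `k ≥ i`, the class of `x_k ^ j` is a nonzero element of degree `j` that `x_k`
annihilates, so the number in degree `j` is positive. Exchanging `x_{i-1}` and `x_i` therefore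
interchanges zero and positive values in the positions `i - 1` and `i`.
-/

/-! ### Powers of the ideal of the upper variables -/

/-- The total exponent of `x_i, …, x_n` in `x^a`. -/
def upperDegree {n : ℕ} (i : ℕ) (a : Fin n →₀ ℕ) : ℕ :=
  ∑ k with i ≤ k.val + 1, a k

/-- The ideal `(x_i, …, x_n)`. -/
noncomputable def upperVariableIdeal (K : Type*) [Field K] (n i : ℕ) :
    Ideal (MvPolynomial (Fin n) K) :=
  Ideal.span (X '' {k : Fin n | i ≤ k.val + 1})

section UpperIdeal

variable {K : Type*} [Field K] {n : ℕ}

theorem upperDegree_add (i : ℕ) (a b : Fin n →₀ ℕ) :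
    upperDegree i (a + b) = upperDegree i a + upperDegree i b := by
  simp [upperDegree, Finset.sum_add_distrib]

theorem upperDegree_single {i : ℕ} (k : Fin n) (m : ℕ) :
    upperDegree i (Finsupp.single k m) = if i ≤ k.val + 1 then m else 0 := by
  simp [upperDegree, Finsupp.single_apply, Finset.sum_ite_eq]

theorem upperDegree_mono (i : ℕ) {a b : Fin n →₀ ℕ} (h : a ≤ b) :
    upperDegree i a ≤ upperDegree i b :=
  Finset.sum_le_sum fun k _ => h k

open scoped Pointwise in
theorem upperIdeal_eq_pow (i j : ℕ) :
    upperIdeal K n i j = upperVariableIdeal K n i ^ (j + 1) := by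
  have hpow : upperVariableIdeal K n i ^ (j + 1) =
      Ideal.span ((X '' {k : Fin n | i ≤ k.val + 1} : Set (MvPolynomial (Fin n) K)) ^ (j + 1)) :=
    Submodule.span_pow _ _
  rw [hpow]
  apply le_antisymm
  · apply Ideal.span_mono
    rintro _ ⟨l, -, hl, rfl⟩
    rw [Set.mem_pow]
    exact ⟨fun t => ⟨X (l t), l t, hl t, rfl⟩, by rw [List.prod_ofFn]⟩
  · apply Ideal.span_mono
    intro f hf
    rw [Set.mem_pow] at hf
    obtain ⟨g, rfl⟩ := hf
    choose l hl hlg using fun t => (g t).2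
    -- The factors are sorted, since the generators carry a monotone index sequence.
    refine ⟨l ∘ Tuple.sort l, Tuple.monotone_sort l, fun t => hl _, ?_⟩
    simp only [List.prod_ofFn, ← hlg, Function.comp_apply]
    exact (Equiv.prod_comp (Tuple.sort l) fun t => (X (l t) : MvPolynomial (Fin n) K)).symm

theorem monomial_mem_upperVariableIdeal_pow {i : ℕ} (m : ℕ) :
    ∀ a : Fin n →₀ ℕ, m ≤ upperDegree i a →
      monomial a (1 : K) ∈ upperVariableIdeal K n i ^ m := by
  induction m with
  | zero => simp
  | succ m ih =>
    intro a ha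
    obtain ⟨k, hk, hak⟩ : ∃ k : Fin n, i ≤ k.val + 1 ∧ a k ≠ 0 := by
      by_contra! h
      have : upperDegree i a = 0 := Finset.sum_eq_zero fun k hk => h k (by simpa using hk)
      omega
    have hsplit : a = (a - Finsupp.single k 1) + Finsupp.single k 1 :=
      (tsub_add_cancel_of_le (by simpa [Finsupp.single_le_iff] using Nat.one_le_iff_ne_zero.2 hak)).symm
    have hdeg : m ≤ upperDegree i (a - Finsupp.single k 1) := by
      rw [hsplit, upperDegree_add, upperDegree_single, if_pos hk] at ha
      omega
    rw [hsplit, ← one_mul (1 : K), ← monomial_mul, pow_succ]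
    exact Ideal.mul_mem_mul (ih _ hdeg) (Ideal.subset_span ⟨k, hk, rfl⟩)

/-- The generators need not be minimal: all monomials of upper degree at least `m` are taken. -/
theorem upperVariableIdeal_pow_eq_span (i m : ℕ) :
    upperVariableIdeal K n i ^ m =
      Ideal.span ((fun a => monomial a (1 : K)) '' {a : Fin n →₀ ℕ | m ≤ upperDegree i a}) := by
  apply le_antisymm
  · induction m with
    | zero =>
      rw [pow_zero, Ideal.one_eq_top, top_le_iff, Ideal.eq_top_iff_one]
      exact Ideal.subset_span ⟨0, by simp, rfl⟩
    | succ m ih =>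
      rw [pow_succ]
      refine (Ideal.mul_mono_left ih).trans ?_
      rw [upperVariableIdeal, Ideal.span_mul_span', Ideal.span_le]
      rintro _ ⟨_, ⟨a, ha, rfl⟩, _, ⟨k, hk, rfl⟩, rfl⟩
      refine Ideal.subset_span ⟨a + Finsupp.single k 1, ?_, ?_⟩
      · simp only [Set.mem_ofPred_eq] at ha hk ⊢
        rw [upperDegree_add, upperDegree_single, if_pos hk]
        omega
      · simp [X, monomial_mul]
  · rw [Ideal.span_le]
    rintro _ ⟨a, ha, rfl⟩
    exact monomial_mem_upperVariableIdeal_pow m a ha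

/-- Membership in `(x_i, …, x_n)^{j+1} + (x_t : t ∈ T)` is decided monomial by monomial. -/
theorem mem_upperIdeal_sup {i j : ℕ} {T : Set (Fin n)} {f : MvPolynomial (Fin n) K} :
    f ∈ upperIdeal K n i j ⊔ Ideal.span (X '' T) ↔
      ∀ a ∈ f.support, j + 1 ≤ upperDegree i a ∨ ∃ t ∈ T, a t ≠ 0 := by
  have hT : (X '' T : Set (MvPolynomial (Fin n) K)) =
      (fun a => monomial a (1 : K)) '' ((fun t => Finsupp.single t 1) '' T) := by
    rw [Set.image_image]; rfl
  rw [upperIdeal_eq_pow, upperVariableIdeal_pow_eq_span, hT, ← Ideal.span_union,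
    ← Set.image_union, mem_ideal_span_monomial_image]
  refine forall₂_congr fun a _ => ⟨?_, ?_⟩
  · rintro ⟨b, hb | ⟨t, ht, rfl⟩, hba⟩
    · exact Or.inl (le_trans hb (upperDegree_mono i hba))
    · refine Or.inr ⟨t, ht, ?_⟩
      have := hba t
      simp at this
      omega
  · rintro (h | ⟨t, ht, hat⟩)
    · exact ⟨a, Or.inl h, le_rfl⟩
    · exact ⟨_, Or.inr ⟨t, ht, rfl⟩, by
        simpa [Finsupp.single_le_iff] using Nat.one_le_iff_ne_zero.2 hat⟩

theorem mem_upperIdeal {i j : ℕ} {f : MvPolynomial (Fin n) K} :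
    f ∈ upperIdeal K n i j ↔ ∀ a ∈ f.support, j + 1 ≤ upperDegree i a := by
  simpa using mem_upperIdeal_sup (i := i) (j := j) (T := ∅) (f := f)

theorem monomial_mem_upperIdeal {i j : ℕ} {a : Fin n →₀ ℕ} :
    monomial a (1 : K) ∈ upperIdeal K n i j ↔ j + 1 ≤ upperDegree i a := by
  rw [mem_upperIdeal]
  simp

theorem isGradedIdeal_upperIdeal (i j : ℕ) : IsGradedIdeal (upperIdeal K n i j) := by
  intro f hf d
  rw [mem_upperIdeal] at hf ⊢
  intro a ha
  apply hf a
  rw [mem_support_iff, coeff_homogeneousComponent] at ha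
  rw [mem_support_iff]
  intro h
  simp [h] at ha

theorem isStronglyStable_upperIdeal (i j : ℕ) : IsStronglyStable (upperIdeal K n i j) := by
  refine ⟨fun f hf a ha => monomial_mem_upperIdeal.2 (mem_upperIdeal.1 hf a ha), ?_⟩
  intro a ha k l hkl hak
  rw [monomial_mem_upperIdeal] at ha ⊢
  have hsplit : a = (a - Finsupp.single k 1) + Finsupp.single k 1 :=
    (tsub_add_cancel_of_le (by simpa [Finsupp.single_le_iff] using Nat.one_le_iff_ne_zero.2 hak)).symm
  rw [hsplit] at ha
  rw [upperDegree_add, upperDegree_single] at ha ⊢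
  have : k.val < l.val := hkl
  split_ifs at ha ⊢ <;> omega

end UpperIdeal

/-! ### Unitriangular substitutions and initial ideals -/

section Unitriangular

variable {K : Type*} [Field K] {n : ℕ}

theorem RlexLT.irrefl (a : Fin n →₀ ℕ) : ¬ RlexLT a a := by
  rintro (h | ⟨-, k, -, h⟩) <;> exact lt_irrefl _ h

theorem RlexLT.trans {a b c : Fin n →₀ ℕ} (hab : RlexLT a b) (hbc : RlexLT b c) :
    RlexLT a c := by
  rcases hab with hab | ⟨hab, k, hk, hk'⟩ <;> rcases hbc with hbc | ⟨hbc, l, hl, hl'⟩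
  · exact Or.inl (hab.trans hbc)
  · exact Or.inl (hbc ▸ hab)
  · exact Or.inl (hab ▸ hbc)
  · refine Or.inr ⟨hab.trans hbc, min k l, fun m hm => ?_, ?_⟩
    · rw [hk m (lt_of_lt_of_le hm (min_le_left _ _)), hl m (lt_of_lt_of_le hm (min_le_right _ _))]
    · rcases lt_trichotomy k l with h | rfl | h
      · rwa [min_eq_left h.le, ← hl k h]
      · rw [min_self]; omega
      · rwa [min_eq_right h.le, hk l h]

theorem RlexLT.add_right {a b : Fin n →₀ ℕ} (h : RlexLT a b) (c : Fin n →₀ ℕ) :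
    RlexLT (a + c) (b + c) := by
  rcases h with h | ⟨h, k, hk, hk'⟩
  · left; simpa using h
  · exact Or.inr ⟨by simpa using h, k, fun l hl => by simp [hk l hl], by simpa using hk'⟩

theorem RlexLT.add_left {a b : Fin n →₀ ℕ} (h : RlexLT a b) (c : Fin n →₀ ℕ) :
    RlexLT (c + a) (c + b) := by
  rw [add_comm c a, add_comm c b]
  exact h.add_right c

theorem rlexLT_single {k l : Fin n} (h : l < k) :
    RlexLT (Finsupp.single l 1) (Finsupp.single k 1) := by
  refine Or.inr ⟨by simp, l, fun m hm => ?_, ?_⟩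
  · rw [Finsupp.single_eq_of_ne hm.ne, Finsupp.single_eq_of_ne (hm.trans h).ne]
  · simp [h.ne']

/-- `x^a` is the leading monomial of `f` with respect to `<_rlex`. -/
def IsRlexLeading (f : MvPolynomial (Fin n) K) (a : Fin n →₀ ℕ) : Prop :=
  a ∈ f.support ∧ ∀ b ∈ f.support, b ≠ a → RlexLT b a

/-- All monomials of `f` are smaller than `x^a`. -/
def RlexBelow (f : MvPolynomial (Fin n) K) (a : Fin n →₀ ℕ) : Prop :=
  ∀ b ∈ f.support, RlexLT b a

/-- Substitutions that send each variable to itself plus smaller monomials. -/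
def IsUnitriangular (φ : MvPolynomial (Fin n) K →ₐ[K] MvPolynomial (Fin n) K) : Prop :=
  ∀ k, RlexBelow (φ (X k) - X k) (Finsupp.single k 1)

theorem RlexBelow.add {f g : MvPolynomial (Fin n) K} {a : Fin n →₀ ℕ}
    (hf : RlexBelow f a) (hg : RlexBelow g a) : RlexBelow (f + g) a := fun b hb => by
  classical
  rcases Finset.mem_union.1 (support_add hb) with h | h
  exacts [hf b h, hg b h]

open scoped Pointwise in
theorem RlexBelow.mul {f g : MvPolynomial (Fin n) K} {a b : Fin n →₀ ℕ}
    (hf : RlexBelow f a) (hg : RlexBelow g b) : RlexBelow (f * g) (a + b) := fun c hc => by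
  classical
  obtain ⟨u, hu, v, hv, rfl⟩ := Finset.mem_add.1 (support_mul f g hc)
  exact ((hf u hu).add_right v).trans ((hg v hv).add_left a)

open scoped Pointwise in
theorem RlexBelow.mul_monomial {f : MvPolynomial (Fin n) K} {a : Fin n →₀ ℕ}
    (hf : RlexBelow f a) (b : Fin n →₀ ℕ) (r : K) :
    RlexBelow (f * monomial b r) (a + b) := fun c hc => by
  classical
  obtain ⟨u, hu, v, hv, rfl⟩ := Finset.mem_add.1 (support_mul f _ hc)
  rw [Finset.mem_singleton.1 (support_monomial_subset hv)]
  exact (hf u hu).add_right b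

theorem IsUnitriangular.rlexBelow_monomial
    {φ : MvPolynomial (Fin n) K →ₐ[K] MvPolynomial (Fin n) K} (hφ : IsUnitriangular φ)
    (a : Fin n →₀ ℕ) : RlexBelow (φ (monomial a 1) - monomial a 1) a := by
  have hzero : RlexBelow (φ (monomial 0 1) - monomial 0 1) 0 := by
    intro b hb
    rw [← one_def, map_one] at hb
    simp at hb
  have hadd : ∀ a b : Fin n →₀ ℕ, RlexBelow (φ (monomial a 1) - monomial a 1) a →
      RlexBelow (φ (monomial b 1) - monomial b 1) b →
      RlexBelow (φ (monomial (a + b) 1) - monomial (a + b) 1) (a + b) := by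
    intro a b ha hb
    have key : φ (monomial (a + b) 1) - monomial (a + b) (1 : K) =
        ((φ (monomial a 1) - monomial a 1) * (φ (monomial b 1) - monomial b 1) +
          (φ (monomial a 1) - monomial a 1) * monomial b 1) +
          (φ (monomial b 1) - monomial b 1) * monomial a 1 := by
      have : monomial (a + b) (1 : K) = monomial a 1 * monomial b 1 := by
        rw [monomial_mul, one_mul]
      rw [this, map_mul]
      ring
    rw [key]
    exact ((ha.mul hb).add (ha.mul_monomial b 1)).add (add_comm b a ▸ hb.mul_monomial a 1)
  induction a using Finsupp.induction_linear with
  | zero => exact hzero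
  | add a b ha hb => exact hadd a b ha hb
  | single k m =>
    induction m with
    | zero => rw [Finsupp.single_zero]; exact hzero
    | succ m ih => rw [Finsupp.single_add]; exact hadd _ _ ih (hφ k)

/-- Expanding `f` in monomials, `φ f - f` only has monomials smaller than some monomial of `f`. -/
theorem IsUnitriangular.isRlexLeading
    {φ : MvPolynomial (Fin n) K →ₐ[K] MvPolynomial (Fin n) K} (hφ : IsUnitriangular φ)
    {f : MvPolynomial (Fin n) K} {a : Fin n →₀ ℕ} (hf : IsRlexLeading f a) :
    IsRlexLeading (φ f) a := by
  classical
  have hdiff : φ f - f =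
      ∑ b ∈ f.support, (φ (monomial b 1) - monomial b 1) * monomial 0 (coeff b f) := by
    have : ∀ b, (φ (monomial b 1) - monomial b 1) * monomial 0 (coeff b f) =
        φ (monomial b (coeff b f)) - monomial b (coeff b f) := by
      intro b
      rw [show monomial b (coeff b f) = C (coeff b f) * monomial b 1 by
        rw [C_mul_monomial, mul_one], map_mul, algHom_C, algebraMap_eq, ← C_apply]
      ring
    simp_rw [this]
    rw [Finset.sum_sub_distrib, ← map_sum, ← f.as_sum]
  have hbelow : RlexBelow (φ f - f) a := by
    intro c hc
    rw [hdiff] at hc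
    obtain ⟨b, hb, hcb⟩ := Finset.mem_biUnion.1 (support_sum hc)
    have hlt := (hφ.rlexBelow_monomial b).mul_monomial 0 (coeff b f) c hcb
    rw [add_zero] at hlt
    rcases eq_or_ne b a with rfl | hba
    · exact hlt
    · exact hlt.trans (hf.2 b hb hba)
  have hsum : φ f = f + (φ f - f) := by ring
  refine ⟨?_, fun b hb hba => ?_⟩
  · have : coeff a (φ f - f) = 0 := by
      by_contra h
      exact RlexLT.irrefl a (hbelow a (mem_support_iff.2 h))
    rw [mem_support_iff, hsum, coeff_add, this, add_zero]
    exact mem_support_iff.1 hf.1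
  · rw [hsum] at hb
    rcases Finset.mem_union.1 (support_add hb) with h | h
    exacts [hf.2 b h hba, hbelow b h]

theorem rlexInitialIdeal_eq_span (I : Ideal (MvPolynomial (Fin n) K)) :
    rlexInitialIdeal I =
      Ideal.span {m | ∃ f ∈ I, ∃ a, IsRlexLeading f a ∧ m = monomial a 1} := by
  simp only [rlexInitialIdeal, IsRlexLeading, and_assoc]

/-- If `J` is carried into the monomial ideal `I`, and `I` into `J`, by unitriangular
substitutions, which keep leading monomials, then `in(J) = I`. -/
theorem rlexInitialIdeal_eq_of_unitriangular {I J : Ideal (MvPolynomial (Fin n) K)}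
    {S : Set (Fin n →₀ ℕ)} (hI : I = Ideal.span ((fun a => monomial a (1 : K)) '' S))
    {φ ψ : MvPolynomial (Fin n) K →ₐ[K] MvPolynomial (Fin n) K}
    (hφ : IsUnitriangular φ) (hψ : IsUnitriangular ψ)
    (hJI : ∀ f ∈ J, φ f ∈ I) (hIJ : ∀ f ∈ I, ψ f ∈ J) :
    rlexInitialIdeal J = I := by
  rw [rlexInitialIdeal_eq_span]
  apply le_antisymm
  · rw [Ideal.span_le]
    rintro _ ⟨f, hf, a, ha, rfl⟩
    have hmem := hJI f hf
    rw [hI, mem_ideal_span_monomial_image] at hmem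
    rw [SetLike.mem_coe, hI, mem_ideal_span_monomial_image]
    intro b hb
    rw [Finset.mem_singleton.1 (support_monomial_subset hb)]
    exact hmem a (hφ.isRlexLeading ha).1
  · conv_lhs => rw [hI]
    rw [Ideal.span_le]
    rintro _ ⟨a, ha, rfl⟩
    have hlead : IsRlexLeading (monomial a (1 : K)) a := by
      refine ⟨by simp, fun b hb hba => absurd ?_ hba⟩
      exact Finset.mem_singleton.1 (support_monomial_subset hb)
    exact Ideal.subset_span ⟨_, hIJ _ (hI ▸ Ideal.subset_span ⟨a, ha, rfl⟩), a,
      hψ.isRlexLeading hlead, rfl⟩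

/-- A substitution that adds to each variable a combination of variables of smaller index. -/
theorem isUnitriangular_aeval (c : Fin n → Fin n → K) (hc : ∀ l k, k ≤ l → c l k = 0) :
    IsUnitriangular (aeval fun k => X k + ∑ l, C (c l k) * X l) := by
  classical
  intro k b hb
  rw [aeval_X, add_sub_cancel_left] at hb
  obtain ⟨l, -, hl⟩ := Finset.mem_biUnion.1 (support_sum hb)
  rcases le_or_gt k l with h | h
  · -- The coefficient vanishes, so there is no monomial to compare.
    simp [hc l k h] at hl
  · rw [C_mul_X_eq_monomial] at hl
    rw [Finset.mem_singleton.1 (support_monomial_subset hl)]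
    exact rlexLT_single h

end Unitriangular

/-! ### The generic initial ideal -/

section Gin

variable {K : Type*} [Field K] {n : ℕ}

/-- The block of `γ` with the rows and columns `i, …, n`. -/
def upperBlock (i : ℕ) (γ : GL (Fin n) K) :
    Matrix {k : Fin n // i ≤ k.val + 1} {k : Fin n // i ≤ k.val + 1} K :=
  γ.val.submatrix Subtype.val Subtype.val

/-- The lower coordinates of the basis of the span of `γ(x_i), …, γ(x_n)` that is
`x_k + ∑ l, lowerCoeff i γ l k • x_l`, with `i ≤ k ≤ n` and `l < i`: the columns `i, …, n` of `γ`
times the inverse of the upper block. -/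
noncomputable def lowerCoeff (i : ℕ) (γ : GL (Fin n) K) (l k : Fin n) : K :=
  if h : i ≤ k.val + 1 then
    if i ≤ l.val + 1 then 0 else ∑ m, γ.val l m.val * (upperBlock i γ)⁻¹ m ⟨k, h⟩
  else 0

theorem lowerCoeff_eq_zero (i : ℕ) (γ : GL (Fin n) K) {l k : Fin n} (h : k ≤ l) :
    lowerCoeff i γ l k = 0 := by
  have : k.val ≤ l.val := h
  unfold lowerCoeff
  split_ifs
  · rfl
  · omega
  · rfl

theorem sum_mul_inv_upperBlock {i : ℕ} {γ : GL (Fin n) K} (hγ : (upperBlock i γ).det ≠ 0)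
    (l : Fin n) (k : {k : Fin n // i ≤ k.val + 1}) :
    ∑ m, γ.val l m.val * (upperBlock i γ)⁻¹ m k =
      (if l = k.val then 1 else 0) + lowerCoeff i γ l k.val := by
  rw [lowerCoeff, dif_pos k.2]
  split_ifs with hlk hl hl
  · have := congrFun₂ (Matrix.mul_nonsing_inv (upperBlock i γ) (Ne.isUnit hγ)) ⟨l, hl⟩ k
    rw [Matrix.mul_apply, Matrix.one_apply, if_pos (Subtype.ext hlk)] at this
    rw [add_zero, ← this]
    rfl
  · exact absurd (hlk ▸ k.2) hl
  · have := congrFun₂ (Matrix.mul_nonsing_inv (upperBlock i γ) (Ne.isUnit hγ)) ⟨l, hl⟩ k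
    rw [Matrix.mul_apply, Matrix.one_apply, if_neg fun h => hlk (congrArg Subtype.val h)] at this
    rw [add_zero, ← this]
    rfl
  · rw [zero_add]

theorem sum_lowerCoeff_mul {i : ℕ} {γ : GL (Fin n) K} (hγ : (upperBlock i γ).det ≠ 0)
    {l : Fin n} (hl : ¬ i ≤ l.val + 1) (m : {k : Fin n // i ≤ k.val + 1}) :
    ∑ k, lowerCoeff i γ l k * γ.val k m.val = γ.val l m.val := by
  have hsub : ∑ k, lowerCoeff i γ l k * γ.val k m.val =
      ∑ k : {k : Fin n // i ≤ k.val + 1}, lowerCoeff i γ l k.val * γ.val k.val m.val := by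
    rw [← Finset.sum_subtype (Finset.univ.filter fun k : Fin n => i ≤ k.val + 1) (by simp)
      (fun k => lowerCoeff i γ l k * γ.val k m.val)]
    refine (Finset.sum_filter_of_ne fun k _ hk => ?_).symm
    by_contra h
    simp [lowerCoeff, h] at hk
  -- The `l`-th row of `γ`, cut to the columns of the block, times `B⁻¹ B`, for the block `B`.
  have hrow : Matrix.vecMul (Matrix.vecMul (fun m => γ.val l m.val) (upperBlock i γ)⁻¹)
      (upperBlock i γ) m = γ.val l m.val := by
    rw [Matrix.vecMul_vecMul, Matrix.nonsing_inv_mul _ (Ne.isUnit hγ), Matrix.vecMul_one]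
  rw [hsub, ← hrow]
  refine Finset.sum_congr rfl fun k _ => ?_
  rw [lowerCoeff, dif_pos k.2, if_neg hl]
  rfl

theorem linearSubstitution_X (γ : GL (Fin n) K) (k : Fin n) :
    linearSubstitution γ (X k) = ∑ l, C (γ.val l k) * X l := by
  rw [linearSubstitution, aeval_X]

/-- A combination of `γ(x_i), …, γ(x_n)` that agrees with `x_k` up to `x_1, …, x_{i-1}`. -/
theorem X_add_sum_lowerCoeff {i : ℕ} {γ : GL (Fin n) K} (hγ : (upperBlock i γ).det ≠ 0)
    (k : {k : Fin n // i ≤ k.val + 1}) :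
    X k.val + ∑ l, C (lowerCoeff i γ l k.val) * X l =
      ∑ m, C ((upperBlock i γ)⁻¹ m k) * linearSubstitution γ (X m.val) := by
  simp_rw [linearSubstitution_X, Finset.mul_sum]
  rw [Finset.sum_comm]
  have : ∀ l, ∑ m, C ((upperBlock i γ)⁻¹ m k) * (C (γ.val l m.val) * X l) =
      (C (∑ m, γ.val l m.val * (upperBlock i γ)⁻¹ m k) * X l : MvPolynomial (Fin n) K) := by
    intro l
    rw [map_sum, Finset.sum_mul]
    refine Finset.sum_congr rfl fun m _ => ?_
    rw [C_mul]
    ring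
  simp_rw [this, sum_mul_inv_upperBlock hγ, C_add, add_mul, Finset.sum_add_distrib]
  simp

theorem X_mem_upperVariableIdeal {i : ℕ} {k : Fin n} (hk : i ≤ k.val + 1) :
    (X k : MvPolynomial (Fin n) K) ∈ upperVariableIdeal K n i :=
  Ideal.subset_span ⟨k, hk, rfl⟩

/-- Subtracting the lower coordinates carries `γ(x_m)`, for `m ≥ i`, into `(x_i, …, x_n)`. -/
theorem aeval_sub_lowerCoeff_mem {i : ℕ} {γ : GL (Fin n) K} (hγ : (upperBlock i γ).det ≠ 0)
    (m : {k : Fin n // i ≤ k.val + 1}) :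
    aeval (fun k => X k + ∑ l, C (-lowerCoeff i γ l k) * X l) (linearSubstitution γ (X m.val)) ∈
      upperVariableIdeal K n i := by
  have key : aeval (fun k => X k + ∑ l, C (-lowerCoeff i γ l k) * X l)
      (linearSubstitution γ (X m.val)) =
      ∑ l, C (γ.val l m.val - ∑ k, lowerCoeff i γ l k * γ.val k m.val) *
        (X l : MvPolynomial (Fin n) K) := by
    simp_rw [linearSubstitution_X, map_sum, map_mul, aeval_X, algHom_C, algebraMap_eq, mul_add,
      Finset.sum_add_distrib, Finset.mul_sum]
    rw [Finset.sum_comm (γ := Fin n), ← Finset.sum_add_distrib]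
    refine Finset.sum_congr rfl fun l _ => ?_
    rw [C_sub, sub_mul, map_sum, Finset.sum_mul, sub_eq_add_neg, ← Finset.sum_neg_distrib]
    congr 1
    refine Finset.sum_congr rfl fun k _ => ?_
    rw [C_neg, C_mul]
    ring
  rw [key]
  refine Ideal.sum_mem _ fun l _ => ?_
  by_cases hl : i ≤ l.val + 1
  · exact Ideal.mul_mem_left _ _ (X_mem_upperVariableIdeal hl)
  · rw [sum_lowerCoeff_mul hγ hl, sub_self, C_0, zero_mul]
    exact Ideal.zero_mem _

/-- The substitutions that add and subtract the lower coordinates are unitriangular and carry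
`P ^ (j + 1)` into `γ(P ^ (j + 1))` and back, where `P = (x_i, …, x_n)`. -/
theorem rlexInitialIdeal_map_upperIdeal {i j : ℕ} {γ : GL (Fin n) K}
    (hγ : (upperBlock i γ).det ≠ 0) :
    rlexInitialIdeal ((upperIdeal K n i j).map (linearSubstitution γ)) = upperIdeal K n i j := by
  refine rlexInitialIdeal_eq_of_unitriangular
    (S := {a : Fin n →₀ ℕ | j + 1 ≤ upperDegree i a})
    (by rw [upperIdeal_eq_pow, upperVariableIdeal_pow_eq_span])
    (isUnitriangular_aeval (fun l k => -lowerCoeff i γ l k)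
      fun l k h => by rw [lowerCoeff_eq_zero i γ h, neg_zero])
    (isUnitriangular_aeval (lowerCoeff i γ) fun l k h => lowerCoeff_eq_zero i γ h) ?_ ?_
  · suffices h : ((upperIdeal K n i j).map (linearSubstitution γ)).map
        (aeval fun k => X k + ∑ l, C (-lowerCoeff i γ l k) * X l) ≤ upperIdeal K n i j from
      fun f hf => h (Ideal.mem_map_of_mem _ hf)
    rw [upperIdeal_eq_pow, Ideal.map_pow, Ideal.map_pow]
    refine Ideal.pow_right_mono ?_ _
    rw [Ideal.map_le_iff_le_comap, Ideal.map_le_iff_le_comap]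
    refine Ideal.span_le.2 ?_
    rintro _ ⟨m, hm, rfl⟩
    exact aeval_sub_lowerCoeff_mem hγ ⟨m, hm⟩
  · suffices h : (upperIdeal K n i j).map (aeval fun k => X k + ∑ l, C (lowerCoeff i γ l k) * X l) ≤
        (upperIdeal K n i j).map (linearSubstitution γ) from
      fun f hf => h (Ideal.mem_map_of_mem _ hf)
    rw [upperIdeal_eq_pow, Ideal.map_pow, Ideal.map_pow]
    refine Ideal.pow_right_mono ?_ _
    rw [Ideal.map_le_iff_le_comap]
    refine Ideal.span_le.2 ?_
    rintro _ ⟨k, hk, rfl⟩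
    rw [SetLike.mem_coe, Ideal.mem_comap, aeval_X, X_add_sum_lowerCoeff hγ ⟨k, hk⟩]
    exact Ideal.sum_mem _ fun m _ => Ideal.mul_mem_left _ _
      (Ideal.mem_map_of_mem _ (X_mem_upperVariableIdeal m.2))

theorem isRlexGin_upperIdeal (i j : ℕ) :
    IsRlexGin (upperIdeal K n i j) (upperIdeal K n i j) := by
  refine ⟨{γ | (upperBlock i γ).det ≠ 0}, ⟨1, ?_⟩, ?_, fun γ hγ =>
    rlexInitialIdeal_map_upperIdeal hγ⟩
  · have : upperBlock i (1 : GL (Fin n) K) = 1 := by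
      rw [upperBlock, Units.val_one, Matrix.submatrix_one _ Subtype.val_injective]
    rw [Set.mem_ofPred_eq, this, Matrix.det_one]
    exact one_ne_zero
  · refine ⟨{Matrix.det (Matrix.of fun k l : {k : Fin n // i ≤ k.val + 1} => X (k.val, l.val))}, ?_⟩
    ext γ
    simp only [Set.mem_ofPred_eq, Set.mem_singleton_iff, exists_eq_left]
    rw [RingHom.map_det]
    have : (eval fun e : Fin n × Fin n => γ.val e.1 e.2).mapMatrix (Matrix.of
        fun k l : {k : Fin n // i ≤ k.val + 1} => X (k.val, l.val)) = upperBlock i γ := by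
      ext k l
      simp [upperBlock]
    rw [this]

/-- Over an infinite field, two non-empty Zariski-open subsets of `GL_n(K)` meet. -/
theorem IsZariskiOpen.inter_nonempty [Infinite K] {U V : Set (GL (Fin n) K)}
    (hU : IsZariskiOpen U) (hV : IsZariskiOpen V) (hU' : U.Nonempty) (hV' : V.Nonempty) :
    (U ∩ V).Nonempty := by
  obtain ⟨F, rfl⟩ := hU
  obtain ⟨G, rfl⟩ := hV
  obtain ⟨γ, p, hp, hpγ⟩ := hU'
  obtain ⟨δ, q, hq, hqδ⟩ := hV'
  have hp0 : p ≠ 0 := by rintro rfl; simp at hpγ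
  have hq0 : q ≠ 0 := by rintro rfl; simp at hqδ
  have heval : ∀ M : Fin n × Fin n → K,
      eval M (Matrix.det (Matrix.of fun k l : Fin n => X (k, l))) =
        Matrix.det (Matrix.of fun k l => M (k, l)) := by
    intro M
    rw [RingHom.map_det]
    congr 1
    ext k l
    simp
  have hd0 : Matrix.det (Matrix.of fun k l : Fin n => (X (k, l) : MvPolynomial (Fin n × Fin n) K))
      ≠ 0 := by
    intro h
    have := heval fun e => (1 : Matrix (Fin n) (Fin n) K) e.1 e.2
    rw [h, map_zero] at this
    exact zero_ne_one (this.trans Matrix.det_one)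
  -- A common point of the two loci, at which the determinant does not vanish either.
  obtain ⟨M, hM⟩ : ∃ M, eval M (p * q * Matrix.det (Matrix.of fun k l : Fin n => X (k, l))) ≠ 0 := by
    by_contra! h
    exact mul_ne_zero (mul_ne_zero hp0 hq0) hd0 (MvPolynomial.funext fun M => by rw [h, map_zero])
  rw [map_mul, map_mul, heval] at hM
  exact ⟨Matrix.GeneralLinearGroup.mkOfDetNeZero (Matrix.of fun k l => M (k, l))
    (right_ne_zero_of_mul hM), ⟨p, hp, left_ne_zero_of_mul (left_ne_zero_of_mul hM)⟩,
    ⟨q, hq, right_ne_zero_of_mul (left_ne_zero_of_mul hM)⟩⟩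

theorem IsRlexGin.rlexGin_eq [Infinite K] {I G : Ideal (MvPolynomial (Fin n) K)}
    (h : IsRlexGin I G) : rlexGin I = G := by
  have hex : ∃ G, IsRlexGin I G := ⟨G, h⟩
  rw [rlexGin, dif_pos hex]
  obtain ⟨U, hU, hUo, hUG⟩ := hex.choose_spec
  obtain ⟨V, hV, hVo, hVG⟩ := h
  obtain ⟨γ, hγU, hγV⟩ := hUo.inter_nonempty hVo hU hV
  rw [← hUG γ hγU, hVG γ hγV]

end Gin

/-! ### Annihilator numbers along permuted variables -/

section Annihilator

variable {K : Type*} [Field K] {n : ℕ}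

theorem setOf_X_comp_eq_image (σ : Equiv.Perm (Fin n)) (r : ℕ) :
    {f : MvPolynomial (Fin n) K | ∃ k : Fin n, k.val < r ∧ (X ∘ σ) k = f} =
      X '' (σ '' {k | k.val < r}) := by
  rw [Set.image_image]
  rfl

theorem mk_mem_seqSubmodule {I : Ideal (MvPolynomial (Fin n) K)}
    {v : Fin n → MvPolynomial (Fin n) K} {r : ℕ} {f : MvPolynomial (Fin n) K} :
    Ideal.Quotient.mk I f ∈ seqSubmodule (MvPolynomial (Fin n) K ⧸ I) v r ↔
      f ∈ I ⊔ Ideal.span {g | ∃ k : Fin n, k.val < r ∧ v k = g} := by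
  have h : seqSubmodule (MvPolynomial (Fin n) K ⧸ I) v r =
      Submodule.map (Submodule.mkQ I) (Ideal.span {g | ∃ k : Fin n, k.val < r ∧ v k = g}) := by
    rw [seqSubmodule, ← Submodule.range_mkQ I, ← Submodule.map_top, ← Submodule.map_smul'']
    congr 1
    exact Ideal.mul_top _
  rw [h]
  rw [← Submodule.comap_map_mkQ, Submodule.mem_comap]
  rfl

theorem finiteDimensional_annihilatorComponent (I : Ideal (MvPolynomial (Fin n) K))
    (v : Fin n → MvPolynomial (Fin n) K) (k : Fin n) (q : ℕ) :
    FiniteDimensional K (annihilatorComponent (quotientRingGrading I) v k q) := by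
  have : FiniteDimensional K (homogeneousSubmodule (Fin n) K q) :=
    Module.Finite.iff_fg.2 (homogeneousSubmodule_fg _ _ q)
  have : FiniteDimensional K (quotientRingGrading I q) :=
    Module.Finite.map _ _
  have : FiniteDimensional K
      (quotientComponent (quotientRingGrading I) (seqSubmodule _ v k.val) q) :=
    Module.Finite.map _ _
  exact Submodule.finiteDimensional_of_le inf_le_right

/-- If the variable in the (zero-based) position `k` is one of `x_1, …, x_{i-1}`, it is a
nonzerodivisor modulo the ideal and the preceding variables, so its annihilator numbers vanish. -/
theorem symAnnihilatorNumberQuot_eq_zero {i : ℕ} (j : ℕ) (σ : Equiv.Perm (Fin n)) (k : Fin n)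
    (hk : (σ k).val + 1 < i) (q : ℕ) :
    symAnnihilatorNumberQuot (upperIdeal K n i j) (X ∘ σ) (k.val + 1) q = 0 := by
  have hp : 1 ≤ k.val + 1 ∧ k.val + 1 ≤ n := ⟨by omega, k.2⟩
  rw [symAnnihilatorNumberQuot, symAnnihilatorNumber, dif_pos hp]
  change Module.finrank K (annihilatorComponent _ _ k q) = 0
  suffices h : annihilatorComponent (quotientRingGrading (upperIdeal K n i j)) (X ∘ σ) k q = ⊥ by
    exact (congrArg (fun N : Submodule K _ => Module.finrank K N) h).trans (finrank_bot K _)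
  rw [eq_bot_iff]
  rintro _ ⟨hx, _, ⟨f, -, rfl⟩, rfl⟩
  have hx' : (X (σ k)) * f ∈
      upperIdeal K n i j ⊔ Ideal.span (X '' (σ '' {l | l.val < k.val})) := by
    rw [← setOf_X_comp_eq_image, ← mk_mem_seqSubmodule]
    exact (Submodule.Quotient.mk_eq_zero _).1 hx
  suffices h : f ∈ upperIdeal K n i j ⊔ Ideal.span (X '' (σ '' {l | l.val < k.val})) by
    rw [← setOf_X_comp_eq_image, ← mk_mem_seqSubmodule] at h
    exact (Submodule.Quotient.mk_eq_zero _).2 h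
  rw [mem_upperIdeal_sup] at hx' ⊢
  intro a ha
  have hmem : Finsupp.single (σ k) 1 + a ∈ (X (σ k) * f).support := by
    rw [mem_support_iff, coeff_X_mul]
    exact mem_support_iff.1 ha
  refine (hx' _ hmem).imp (fun h => ?_) ?_
  · rwa [upperDegree_add, upperDegree_single, if_neg (by omega), zero_add] at h
  · rintro ⟨_, ⟨l, hl, rfl⟩, h⟩
    refine ⟨_, ⟨l, hl, rfl⟩, ?_⟩
    have hne : σ k ≠ σ l := fun h => by
      rw [σ.injective h] at hl
      exact lt_irrefl l.val hl
    simpa [Finsupp.single_apply, hne] using h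

/-- If the variable in the (zero-based) position `k` is one of `x_i, …, x_n`, its `j`-th
power is a nonzero element of degree `j` in the annihilator. -/
theorem symAnnihilatorNumberQuot_pos {i : ℕ} (j : ℕ) (σ : Equiv.Perm (Fin n)) (k : Fin n)
    (hk : i ≤ (σ k).val + 1) :
    0 < symAnnihilatorNumberQuot (upperIdeal K n i j) (X ∘ σ) (k.val + 1) j := by
  have hp : 1 ≤ k.val + 1 ∧ k.val + 1 ≤ n := ⟨by omega, k.2⟩
  rw [symAnnihilatorNumberQuot, symAnnihilatorNumber, dif_pos hp]
  change 0 < Module.finrank K (annihilatorComponent _ _ k j)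
  have := finiteDimensional_annihilatorComponent (upperIdeal K n i j) (X ∘ σ) k j
  rw [Module.finrank_pos_iff, Submodule.nontrivial_iff_ne_bot, Submodule.ne_bot_iff]
  refine ⟨Submodule.Quotient.mk (Ideal.Quotient.mk _ (X (σ k) ^ j)), ⟨?_, ?_⟩, ?_⟩
  · refine (Submodule.Quotient.mk_eq_zero _).2 (mk_mem_seqSubmodule.2 ?_)
    refine Ideal.mem_sup_left ?_
    change X (σ k) * X (σ k) ^ j ∈ _
    rw [← pow_succ', X_pow_eq_monomial, monomial_mem_upperIdeal, upperDegree_single, if_pos hk]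
  · exact ⟨_, ⟨_, isHomogeneous_X_pow _ _, rfl⟩, rfl⟩
  · intro h
    have h' := mk_mem_seqSubmodule.1 ((Submodule.Quotient.mk_eq_zero _).1 h)
    rw [setOf_X_comp_eq_image, mem_upperIdeal_sup, X_pow_eq_monomial] at h'
    rcases h' (Finsupp.single (σ k) j) (by simp) with h | ⟨_, ⟨l, hl, rfl⟩, h⟩
    · rw [upperDegree_single, if_pos hk] at h
      omega
    · have hne : σ k ≠ σ l := fun h => by
        rw [σ.injective h] at hl
        exact lt_irrefl l.val hl
      simp [hne] at h

theorem isLinearFormBasis_X_comp (σ : Equiv.Perm (Fin n)) :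
    IsLinearFormBasis (X ∘ σ : Fin n → MvPolynomial (Fin n) K) := by
  refine ⟨(linearIndependent_X (Fin n) K).comp _ σ.injective, ?_⟩
  rw [σ.surjective.range_comp, homogeneousSubmodule_one_eq_span_X]

end Annihilator

/-! ### Comparison of the two sequences -/

theorem mainTheorem12 {K : Type*} [Field K] [Infinite K] (n i j : ℕ)
    (hi : 1 ≤ i) (hij : i ≤ j) (hjn : j ≤ n) :
    IsGradedIdeal (upperIdeal K n i j) ∧
    IsStronglyStable (upperIdeal K n i j) ∧
    IsRlexGin (upperIdeal K n i j) (upperIdeal K n i j) ∧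
    rlexGin (upperIdeal K n i j) = upperIdeal K n i j ∧
    (∀ p q : ℕ, symGenericAnnihilatorNumber (upperIdeal K n i j) p q =
      symAnnihilatorNumberQuot (upperIdeal K n i j) X p q) ∧
    (∀ h2 : 2 ≤ i,
      IsLinearFormBasis (swappedVariables K n i h2 (hij.trans hjn)) ∧
      symAnnihilatorNumberQuot (upperIdeal K n i j)
          (swappedVariables K n i h2 (hij.trans hjn)) i j <
        symGenericAnnihilatorNumber (upperIdeal K n i j) i j ∧
      symGenericAnnihilatorNumber (upperIdeal K n i j) (i - 1) j <
        symAnnihilatorNumberQuot (upperIdeal K n i j)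
          (swappedVariables K n i h2 (hij.trans hjn)) (i - 1) j ∧
      ¬ ∀ v : Fin n → MvPolynomial (Fin n) K, IsLinearFormBasis v →
          ∀ p q : ℕ, 1 ≤ p → p ≤ n →
            symGenericAnnihilatorNumber (upperIdeal K n i j) p q ≤
              symAnnihilatorNumberQuot (upperIdeal K n i j) v p q) := by
  have hgin : rlexGin (upperIdeal K n i j) = upperIdeal K n i j :=
    (isRlexGin_upperIdeal i j).rlexGin_eq
  have hsym : ∀ p q : ℕ, symGenericAnnihilatorNumber (upperIdeal K n i j) p q =
      symAnnihilatorNumberQuot (upperIdeal K n i j) X p q := fun p q => by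
    rw [symGenericAnnihilatorNumber, hgin]
  refine ⟨isGradedIdeal_upperIdeal i j, isStronglyStable_upperIdeal i j,
    isRlexGin_upperIdeal i j, hgin, hsym, fun h2 => ?_⟩
  have hin : i ≤ n := hij.trans hjn
  obtain ⟨m, rfl⟩ : ∃ m, i = m + 2 := ⟨i - 2, by omega⟩
  -- The zero-based indices of `x_{i-1}` and `x_i`.
  let s : Fin n := ⟨m, by omega⟩
  let t : Fin n := ⟨m + 1, by omega⟩
  have hswap : swappedVariables K n (m + 2) h2 hin = X ∘ Equiv.swap s t := rfl
  have hbasis := isLinearFormBasis_X_comp (K := K) (Equiv.swap s t)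
  have hlt : symAnnihilatorNumberQuot (upperIdeal K n (m + 2) j) (X ∘ Equiv.swap s t) (m + 2) j <
      symGenericAnnihilatorNumber (upperIdeal K n (m + 2) j) (m + 2) j := by
    have hzero := symAnnihilatorNumberQuot_eq_zero (K := K) (i := m + 2) j (Equiv.swap s t) t
      (by rw [Equiv.swap_apply_right]; exact Nat.lt_succ_self _) j
    have hpos := symAnnihilatorNumberQuot_pos (K := K) (i := m + 2) j (Equiv.refl _) t le_rfl
    rw [hsym]
    exact hzero.trans_lt hpos
  rw [hswap]
  refine ⟨hbasis, hlt, ?_, fun h => ?_⟩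
  · have hzero := symAnnihilatorNumberQuot_eq_zero (K := K) (i := m + 2) j (Equiv.refl _) s
      (Nat.lt_succ_self _) j
    have hpos := symAnnihilatorNumberQuot_pos (K := K) (i := m + 2) j (Equiv.swap s t) s
      (by rw [Equiv.swap_apply_left])
    rw [hsym]
    exact hzero.trans_lt hpos
  · exact absurd (h _ hbasis (m + 2) j hi hin) (not_le.2 hlt)
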